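/- Let $d\ge 1$, $\mathbb T=\mathbb R/\mathbb Z$, $x=(x_1,\underline x)\in\mathbb T\times\mathbb T^{d-1}$. Let $f\in C^\infty(\mathbb R)$ have exactly three zeros $\rho_-<\rho_*<\rho_+$, with $f'(\rho_\pm)<0$ and $\int_{\rho_-}^{\rho_+}f(u)\,du=0$, and let $g_1,g_2\in C^\infty([\rho_-,\rho_+])$ be positive. For $K\ge 1$ let $v=v^K$ be a solution of $v''+Kf(v)=0$ on $\mathbb T$ which takes the value $\rho_*$ at exactly two points of $\mathbb T$, with $v(0)=\rho_*$ and $v'(0)<0$. Put $\sqrt K\,\mathbb T=[-\sqrt K/2,\sqrt K/2)$ (periodic), $\bar v(z)=v(z/\sqrt K)$ for $z\in\sqrt K\,\mathbb T$, $\mathcal A^K_z=-\partial_z^2-f'(\bar v(z))$ and $\Delta_{\underline x}=\sum_{i=2}^d\partial_{x_i}^2$. Let $\dot{\mathbb W}=(\dot W^1,\dots,\dot W^d)$ and $\dot W$ be $d+1$ independent space-time Gaussian white noises on $[0,\infty)\times\mathbb T^d$, and let $\Phi$ be a continuous $\mathcal D'(\mathbb T^d)$-valued process, with $\Phi(0)$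 independent of the noises, which solves (in the weak sense, i.e. tested against smooth functions $G(t,x)$) the linear SPDE $$\partial_t\Phi=\Delta\Phi+Kf'(v(x_1))\Phi+\nabla\cdot\big(g_1(v(x_1))\dot{\mathbb W}\big)+\sqrt K\,g_2(v(x_1))\dot W .$$ Let $\widetilde\Psi(t,z,\underline x)=\Phi(t,z/\sqrt K,\underline x)$ on $\sqrt K\,\mathbb T\times\mathbb T^{d-1}$ (as a distribution: $\langle\widetilde\Psi(t),H\rangle=\sqrt K\,\langle\Phi(t),H(\sqrt K\,\cdot,\cdot)\rangle$) and $\Psi=K^{-3/4}\,\widetilde\Psi$. Then $\widetilde\Psi$ and $\Psi$ satisfy the following SPDEs in law. More precisely, there are $d+1$ independent space-time Gaussian white noises on $[0,\infty)\times\sqrt K\,\mathbb T\times\mathbb T^{d-1}$, again denoted $\dot W^1$, $\dot{\mathbb W}^2=(\dot W^2,\dots,\dot W^d)$ and $\dot W$, defined on the same probability space and independent of the initial values, such that, in the same weak sense, $$\partial_t\widetilde\Psi=(-K\mathcal A^K_z+\Delta_{\underline x})\widetilde\Psi+K^{3/4}\partial_z\big(g_1(\bar v(z))\dot W^1\big)+K^{1/4}g_1(\bar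 v(z))\nabla_{\underline x}\cdot\dot{\mathbb W}^2+K^{3/4}g_2(\bar v(z))\dot W$$ and $$\partial_t\Psi=(-K\mathcal A^K_z+\Delta_{\underline x})\Psi+\partial_z\big(g_1(\bar v(z))\dot W^1\big)+K^{-1/2}g_1(\bar v(z))\nabla_{\underline x}\cdot\dot{\mathbb W}^2+g_2(\bar v(z))\dot W .$$ Moreover the noise terms in the equation for $\Psi$ are $O(1)$ as $K\to\infty$: there is a constant $C$, depending only on $d,f,g_1,g_2$ (in particular not on $K$), such that for every $K\ge1$, every $t\ge 0$ and every smooth test function $G(s,z,\underline x)$, periodic in $(z,\underline x)$, the contribution of each of the $d+1$ noises to that equation, integrated against $G$ over $[0,t]\times\sqrt K\,\mathbb T\times\mathbb T^{d-1}$, has second moment at most $C\int_0^t\int_{\sqrt K\,\mathbb T\times\mathbb T^{d-1}}\big(|G|^2+|\nabla G|^2\big)\,dz\,d\underline x\,ds$, where $\nabla=(\partial_z,\nabla_{\underline x})$. -/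

import Mathlib

open MeasureTheory ProbabilityTheory Set
open scoped ContDiff

noncomputable section

namespace InterfaceFluctuation

/-! ### Tori, test functions and distributions

The torus `∏ i, ℝ / (L i) ℤ` is described by its period vector `L : Fin d → ℝ`; functions on it are
functions on `ℝ^d` which have period `L i` in the `i`-th variable. -/

/-- Periods of the unit torus `𝕋^d`. -/
def unitPeriods (d : ℕ) : Fin d → ℝ := fun _ => 1

/-- Periods `(√K, 1, …, 1)` of the stretched torus `√K 𝕋 × 𝕋^(d-1)`. -/
def stretchedPeriods (d : ℕ) [NeZero d] (K : ℝ) : Fin d → ℝ := fun i => if i = 0 then √K else 1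

/-- The space `C^∞` of smooth periodic test functions on the torus with periods `L`. -/
def testFunctions {d : ℕ} (L : Fin d → ℝ) : Submodule ℝ ((Fin d → ℝ) → ℝ) where
  carrier := {H | ContDiff ℝ ∞ H ∧ ∀ i x, H (x + Pi.single i (L i)) = H x}
  add_mem' := by
    rintro a b ⟨ha, ha'⟩ ⟨hb, hb'⟩
    exact ⟨ha.add hb, fun i x => by simp [ha' i x, hb' i x]⟩
  zero_mem' := ⟨contDiff_const, fun _ _ => rfl⟩
  smul_mem' := by
    rintro c a ⟨ha, ha'⟩
    exact ⟨contDiff_const.smul ha, fun i x => by simp [ha' i x]⟩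

/-- Test functions, as a type. -/
abbrev TestFn {d : ℕ} (L : Fin d → ℝ) : Type := testFunctions L

/-- The space `𝒟'` of distributions on the torus with periods `L`: linear functionals on `C^∞`
that are continuous, i.e. bounded by a multiple of some `C^n`-norm. -/
def distributions {d : ℕ} (L : Fin d → ℝ) : Submodule ℝ (TestFn L →ₗ[ℝ] ℝ) where
  carrier := {T | ∃ (C : ℝ) (n : ℕ), ∀ (H : TestFn L) (M : ℝ),
    (∀ k ≤ n, ∀ x, ‖iteratedFDeriv ℝ k H.1 x‖ ≤ M) → |T H| ≤ C * M}
  add_mem' := by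
    rintro S T ⟨C, n, h⟩ ⟨C', n', h'⟩
    refine ⟨C + C', max n n', fun H M hM => ?_⟩
    have h1 := h H M fun k hk => hM k (hk.trans (le_max_left _ _))
    have h2 := h' H M fun k hk => hM k (hk.trans (le_max_right _ _))
    calc |(S + T) H| ≤ |S H| + |T H| := abs_add_le _ _
      _ ≤ (C + C') * M := by linarith
  zero_mem' := ⟨0, 0, fun _ _ _ => by simp⟩
  smul_mem' := by
    rintro c T ⟨C, n, h⟩
    refine ⟨|c| * C, n, fun H M hM => ?_⟩
    have := mul_le_mul_of_nonneg_left (h H M hM) (abs_nonneg c)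
    simpa [abs_mul, mul_assoc] using this

/-- Distributions, as a type. -/
abbrev TorusDistribution {d : ℕ} (L : Fin d → ℝ) : Type := distributions L

/-- The duality `⟨T, H⟩` between `𝒟'` and `C^∞`. -/
def pairing {d : ℕ} {L : Fin d → ℝ} (T : TorusDistribution L) (H : TestFn L) : ℝ := T.1 H

/-- The partial derivative `∂_i` on test functions. -/
def partialDeriv {d : ℕ} {L : Fin d → ℝ} (i : Fin d) : TestFn L →ₗ[ℝ] TestFn L where
  toFun H := ⟨fun x => fderiv ℝ H.1 x (Pi.single i 1),
    (H.2.1.fderiv_right (m := ∞) (by simp)).clm_apply contDiff_const, fun j x => by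
      have h : (fun y => H.1 (y + Pi.single j (L j))) = H.1 := funext (H.2.2 j)
      change fderiv ℝ H.1 (x + Pi.single j (L j)) (Pi.single i 1) = _
      rw [← fderiv_comp_add_right, h]⟩
  map_add' H G := by
    ext x
    have hH := (H.2.1.differentiable (by simp)) x
    have hG := (G.2.1.differentiable (by simp)) x
    simp [fderiv_add hH hG]
  map_smul' c H := by
    ext x
    have hH := (H.2.1.differentiable (by simp)) x
    simp [fderiv_const_smul hH]

/-- Multiplication of test functions by a fixed smooth periodic function. -/
def mulBy {d : ℕ} {L : Fin d → ℝ} (c : TestFn L) : TestFn L →ₗ[ℝ] TestFn L where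
  toFun H := ⟨fun x => c.1 x * H.1 x, c.2.1.mul H.2.1, fun i x => by simp [c.2.2 i x, H.2.2 i x]⟩
  map_add' H G := by ext x; simp [mul_add]
  map_smul' a H := by ext x; simp; ring

/-- The Laplacian `Δ = ∑_i ∂_i²`. -/
def laplacian {d : ℕ} (L : Fin d → ℝ) : TestFn L →ₗ[ℝ] TestFn L :=
  ∑ i, partialDeriv i ∘ₗ partialDeriv i

/-- The Laplacian in the variables other than the first one. -/
def tangentialLaplacian {d : ℕ} [NeZero d] (L : Fin d → ℝ) : TestFn L →ₗ[ℝ] TestFn L :=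
  ∑ i ∈ Finset.univ.filter (fun i : Fin d => i ≠ 0), partialDeriv i ∘ₗ partialDeriv i

/-- A periodic smooth function of the first variable, as a function on the torus. -/
def ofFirst {d : ℕ} [NeZero d] (L : Fin d → ℝ) (φ : ℝ → ℝ) (hφ : ContDiff ℝ ∞ φ)
    (hper : Function.Periodic φ (L 0)) : TestFn L :=
  ⟨fun x => φ (x 0), hφ.comp (contDiff_apply ℝ ℝ 0), fun i x => by
    rcases eq_or_ne i 0 with rfl | hi
    · simpa using hper (x 0)
    · simp [Pi.single_eq_of_ne hi.symm]⟩

/-- Smooth space-time test functions `G(t,x)`, periodic in `x`. -/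
structure SpaceTimeTest {d : ℕ} (L : Fin d → ℝ) where
  toFun : ℝ → (Fin d → ℝ) → ℝ
  smooth : ContDiff ℝ ∞ (fun p : ℝ × (Fin d → ℝ) => toFun p.1 p.2)
  periodic : ∀ t i x, toFun t (x + Pi.single i (L i)) = toFun t x

/-- The test function `G(t, ·)`. -/
def SpaceTimeTest.slice {d : ℕ} {L : Fin d → ℝ} (G : SpaceTimeTest L) (t : ℝ) : TestFn L :=
  ⟨G.toFun t, G.smooth.comp (contDiff_const.prodMk contDiff_id), G.periodic t⟩

/-- The test function `∂_t G(t, ·)`. -/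
def SpaceTimeTest.timeDeriv {d : ℕ} {L : Fin d → ℝ} (G : SpaceTimeTest L) (t : ℝ) : TestFn L :=
  ⟨fun x => deriv (fun s => G.toFun s x) t, by
    have key : (fun x : Fin d → ℝ => deriv (fun s => G.toFun s x) t) = fun x =>
        fderiv ℝ (fun p : ℝ × (Fin d → ℝ) => G.toFun p.1 p.2) (t, x) (1, 0) := by
      funext x
      have h1 : HasFDerivAt (fun p : ℝ × (Fin d → ℝ) => G.toFun p.1 p.2) _ (t, x) :=
        ((G.smooth.differentiable (by simp)) (t, x)).hasFDerivAt
      have h2 : HasDerivAt (fun s : ℝ => (s, x)) ((1 : ℝ), (0 : Fin d → ℝ)) t :=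
        (hasDerivAt_id t).prodMk (hasDerivAt_const t x)
      exact (h1.comp_hasDerivAt t h2).deriv
    rw [key]
    exact ((G.smooth.fderiv_right (m := ∞) (by simp)).comp
      (contDiff_const.prodMk contDiff_id)).clm_apply contDiff_const,
    fun i x => by simp only [G.periodic]⟩

/-! ### Space-time Gaussian white noise -/

/-- The fundamental cell `∏ i, [-L i / 2, L i / 2)` of the torus. -/
def cell {d : ℕ} (L : Fin d → ℝ) : Set (Fin d → ℝ) :=
  Set.univ.pi fun i => Ico (-(L i) / 2) (L i / 2)

/-- Lebesgue measure on `[0,∞) ×` torus. -/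
def spaceTimeMeasure {d : ℕ} (L : Fin d → ℝ) : Measure (ℝ × (Fin d → ℝ)) :=
  (volume.restrict (Ici (0 : ℝ))).prod (volume.restrict (cell L))

/-- A random field indexed by `L²([0,∞) × torus)`; `W h` stands for the stochastic integral
`∫ h(s,x) W(ds dx)`. -/
abbrev NoiseField {d : ℕ} (L : Fin d → ℝ) (Ω : Type*) : Type _ :=
  Lp ℝ 2 (spaceTimeMeasure L) → Ω → ℝ

/-- `W` is a space-time Gaussian white noise on `[0,∞) ×` torus: a centered Gaussian family with
`E[W(f) W(g)] = ⟨f, g⟩_{L²}`, i.e. `E[Ẇ(t,x) Ẇ(s,y)] = δ(t-s) δ(x-y)`. -/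
structure IsWhiteNoise {d : ℕ} {L : Fin d → ℝ} {Ω : Type*} [MeasurableSpace Ω]
    (W : NoiseField L Ω) (P : Measure Ω) : Prop where
  measurable : ∀ h, Measurable (W h)
  gaussian : IsGaussianProcess W P
  mean : ∀ h, ∫ η, W h η ∂P = 0
  covariance : ∀ f g, ∫ η, W f η * W g η ∂P = inner ℝ f g

/-- `d+1` independent space-time Gaussian white noises: `W (some i)`, `i : Fin d`, are the
components of the vector noise and `W none` is the scalar noise. -/
structure AreIndepWhiteNoises {d : ℕ} {L : Fin d → ℝ} {Ω : Type*} [MeasurableSpace Ω]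
    (W : Option (Fin d) → NoiseField L Ω) (P : Measure Ω) : Prop where
  whiteNoise : ∀ j, IsWhiteNoise (W j) P
  indep : iIndepFun (fun j η h => W j h η) P

/-! ### Linear stochastic PDEs -/

/-- The functions integrated against the noises up to time `t` when the noise
`∑_i ∂_i (σ_i Ẇ^i) + τ Ẇ` is tested with `G`:
`-1_{[0,t]} σ_i ∂_i G` against `W^i`, and `1_{[0,t]} τ G` against `W`. -/
def noiseIntegrand {d : ℕ} {L : Fin d → ℝ} (σ : Fin d → (Fin d → ℝ) → ℝ) (τ : (Fin d → ℝ) → ℝ)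
    (G : SpaceTimeTest L) (t : ℝ) : Option (Fin d) → ℝ × (Fin d → ℝ) → ℝ
  | some i => fun p => (Icc 0 t).indicator 1 p.1 * -(σ i p.2 * (partialDeriv i (G.slice p.1)).1 p.2)
  | none => fun p => (Icc 0 t).indicator 1 p.1 * (τ p.2 * (G.slice p.1).1 p.2)

/-- `Φ` is a `𝒟'`-valued continuous process solving, in the weak sense,
`∂_t Φ = A Φ + ∑_i ∂_i (σ_i(x) Ẇ^i) + τ(x) Ẇ`, `t ≥ 0`, on the torus with periods `L`, driven by
the noises `W` and with initial value independent of the noises. `A` is a formally self-adjoint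
differential operator, given by its action on test functions. -/
structure IsSolution {d : ℕ} {L : Fin d → ℝ} {Ω : Type*} [MeasurableSpace Ω]
    (A : TestFn L →ₗ[ℝ] TestFn L) (σ : Fin d → (Fin d → ℝ) → ℝ) (τ : (Fin d → ℝ) → ℝ)
    (W : Option (Fin d) → NoiseField L Ω) (P : Measure Ω)
    (Φ : ℝ → Ω → TorusDistribution L) : Prop where
  measurable : ∀ t, 0 ≤ t → ∀ H, Measurable fun η => pairing (Φ t η) H
  continuous : ∀ᵐ η ∂P, ∀ H, ContinuousOn (fun t => pairing (Φ t η) H) (Ici 0)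
  initial_indep : IndepFun (fun η H => pairing (Φ 0 η) H) (fun η j h => W j h η) P
  weak_eq : ∀ (G : SpaceTimeTest L) (t : ℝ), 0 ≤ t →
    ∃ hL2 : ∀ j, MemLp (noiseIntegrand σ τ G t j) 2 (spaceTimeMeasure L),
      ∀ᵐ η ∂P, pairing (Φ t η) (G.slice t) = pairing (Φ 0 η) (G.slice 0)
        + (∫ s in (0 : ℝ)..t, pairing (Φ s η) (G.timeDeriv s + A (G.slice s)))
        + ∑ j, W j ((hL2 j).toLp _) η

/-! ### The nonlinearity and the transition profile -/

/-- A smooth function with exactly three zeros `ρm < ρs < ρp`, with `ρm`, `ρp` stable, which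
satisfies the balance condition. -/
structure BistableFunction where
  f : ℝ → ℝ
  ρm : ℝ
  ρs : ℝ
  ρp : ℝ
  smooth : ContDiff ℝ ∞ f
  ρm_lt_ρs : ρm < ρs
  ρs_lt_ρp : ρs < ρp
  zeros : ∀ u, f u = 0 ↔ u = ρm ∨ u = ρs ∨ u = ρp
  deriv_ρm : deriv f ρm < 0
  deriv_ρp : deriv f ρp < 0
  balance : ∫ u in ρm..ρp, f u = 0

/-- The stationary profile `v = v^K` on `𝕋` with two transition layers: `v'' + K f(v) = 0`, `v`
takes the value `ρs` exactly twice on `𝕋`, `v(0) = ρs` and `v'(0) < 0`. -/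
structure TransitionProfile (B : BistableFunction) (K : ℝ) where
  v : ℝ → ℝ
  contDiff : ContDiff ℝ 2 v
  periodic : Function.Periodic v 1
  equation : ∀ x, deriv (deriv v) x + K * B.f (v x) = 0
  layers : {x ∈ Ico (0 : ℝ) 1 | v x = B.ρs}.ncard = 2
  at_zero : v 0 = B.ρs
  deriv_at_zero : deriv v 0 < 0

namespace TransitionProfile

variable {B : BistableFunction} {K : ℝ} (V : TransitionProfile B K)

theorem smooth : ContDiff ℝ ∞ V.v := by
  rw [contDiff_infty]
  intro n
  induction n with
  | zero => exact V.contDiff.of_le (by norm_num)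
  | succ n ih =>
    have h2 : ContDiff ℝ n (deriv (deriv V.v)) := by
      have e : deriv (deriv V.v) = fun x => -(K * B.f (V.v x)) := by
        funext x; linarith [V.equation x]
      rw [e]
      exact (contDiff_const.mul ((B.smooth.of_le (by exact_mod_cast le_top)).comp ih)).neg
    have hd1 : ContDiff ℝ 1 (deriv V.v) :=
      ((contDiff_succ_iff_deriv (n := 1)).1 (V.contDiff.of_le (by norm_num))).2.2
    have h1 : ContDiff ℝ ((n : WithTop ℕ∞) + 1) (deriv V.v) :=
      contDiff_succ_iff_deriv.2 ⟨hd1.differentiable (by simp), by simp, h2⟩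
    push_cast
    exact contDiff_succ_iff_deriv.2 ⟨V.contDiff.differentiable (by simp), by simp,
      h1.of_le (by exact_mod_cast Nat.le_succ n)⟩

theorem smooth_deriv_f : ContDiff ℝ ∞ (deriv B.f) :=
  (contDiff_infty_iff_deriv.1 B.smooth).2

/-- The stretched profile `z ↦ v(z/√K)`. -/
def vbar (z : ℝ) : ℝ := V.v (z / √K)

theorem vbar_smooth : ContDiff ℝ ∞ V.vbar := V.smooth.comp (contDiff_id.div_const _)

theorem vbar_periodic : Function.Periodic V.vbar (√K) := by
  intro z
  rcases eq_or_ne (√K) 0 with h | h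
  · simp [vbar, h]
  · simp only [vbar]
    rw [add_div, div_self h, V.periodic]

variable (d : ℕ) [NeZero d]

/-- `x ↦ f'(v(x_1))` on `𝕋^d`. -/
def potential : TestFn (unitPeriods d) :=
  ofFirst _ (fun y => deriv B.f (V.v y)) (smooth_deriv_f.comp V.smooth)
    fun y => by simp only [unitPeriods]; rw [V.periodic]

/-- `(z, x̲) ↦ f'(vbar(z))` on `√K 𝕋 × 𝕋^(d-1)`. -/
def stretchedPotential : TestFn (stretchedPeriods d K) :=
  ofFirst _ (fun z => deriv B.f (V.vbar z)) (smooth_deriv_f.comp V.vbar_smooth)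
    fun y => by simp only [stretchedPeriods, if_true]; rw [V.vbar_periodic]

/-- `Φ ↦ Δ Φ + K f'(v(x_1)) Φ` on `𝕋^d`. -/
def linearizedOperator : TestFn (unitPeriods d) →ₗ[ℝ] TestFn (unitPeriods d) :=
  laplacian _ + K • mulBy (V.potential d)

/-- The Sturm–Liouville operator `𝒜^K_z = -∂_z² - f'(vbar(z))` on `√K 𝕋 × 𝕋^(d-1)`. -/
def sturmLiouville : TestFn (stretchedPeriods d K) →ₗ[ℝ] TestFn (stretchedPeriods d K) :=
  -(partialDeriv 0 ∘ₗ partialDeriv 0) - mulBy (V.stretchedPotential d)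

/-- `-K 𝒜^K_z + Δ_x̲` on `√K 𝕋 × 𝕋^(d-1)`. -/
def stretchedOperator : TestFn (stretchedPeriods d K) →ₗ[ℝ] TestFn (stretchedPeriods d K) :=
  -(K • V.sturmLiouville d) + tangentialLaplacian _

end TransitionProfile

/-! ### The stretching -/

/-- The dilation `(y_1, y̲) ↦ (√K y_1, y̲)` from `𝕋^d` to `√K 𝕋 × 𝕋^(d-1)`. -/
def dilation (d : ℕ) [NeZero d] (K : ℝ) : (Fin d → ℝ) →L[ℝ] (Fin d → ℝ) :=
  ContinuousLinearMap.pi fun i => stretchedPeriods d K i • ContinuousLinearMap.proj i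

/-- For a test function `H(z, x̲)` on `√K 𝕋 × 𝕋^(d-1)`, the test function
`(y_1, y̲) ↦ H(√K y_1, y̲)` on `𝕋^d`. -/
def pullTest {d : ℕ} [NeZero d] {K : ℝ} :
    TestFn (stretchedPeriods d K) →ₗ[ℝ] TestFn (unitPeriods d) where
  toFun H := ⟨fun y => H.1 (dilation d K y), H.2.1.comp (dilation d K).contDiff, fun i y => by
    have : dilation d K (Pi.single i (unitPeriods d i))
        = Pi.single i (stretchedPeriods d K i) := by
      ext j
      rcases eq_or_ne j i with rfl | hj
      · simp [dilation, unitPeriods]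
      · simp [dilation, Pi.single_eq_of_ne hj]
    change H.1 (dilation d K (y + Pi.single i (unitPeriods d i))) = _
    rw [map_add, this, H.2.2]⟩
  map_add' _ _ := rfl
  map_smul' _ _ := rfl

/-- The distribution `T(z/√K, x̲)` on `√K 𝕋 × 𝕋^(d-1)` obtained from a distribution `T(x_1, x̲)` on
`𝕋^d`. By the change of variables `z = √K y_1`,
`∫ T(z/√K, x̲) H(z, x̲) dz dx̲ = √K ∫ T(y_1, x̲) H(√K y_1, x̲) dy_1 dx̲`. -/
def stretch {d : ℕ} [NeZero d] (K : ℝ) (T : TorusDistribution (unitPeriods d)) :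
    TorusDistribution (stretchedPeriods d K) :=
  ⟨√K • (T.1 ∘ₗ pullTest), by
    obtain ⟨C, n, h⟩ := T.2
    refine ⟨√K * (C * (max 1 ‖dilation d K‖) ^ n), n, fun H M hM => ?_⟩
    have hM0 : 0 ≤ M := (norm_nonneg _).trans (hM 0 (Nat.zero_le _) 0)
    have key := h (pullTest H) (M * (max 1 ‖dilation d K‖) ^ n) fun k hk x => by
      have e : (pullTest H).1 = H.1 ∘ dilation d K := rfl
      rw [e, (dilation d K).iteratedFDeriv_comp_right (n := ∞) H.2.1 x (by exact_mod_cast le_top)]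
      refine (ContinuousMultilinearMap.norm_compContinuousLinearMap_le _ _).trans ?_
      rw [Finset.prod_const, Finset.card_univ, Fintype.card_fin]
      refine mul_le_mul (hM k hk _) ?_ (by positivity) hM0
      exact (pow_le_pow_left₀ (norm_nonneg _) (le_max_right _ _) k).trans
        (pow_le_pow_right₀ (le_max_left _ _) hk)
    have := mul_le_mul_of_nonneg_left key (Real.sqrt_nonneg K)
    simp only [LinearMap.smul_apply, LinearMap.comp_apply, smul_eq_mul, abs_mul,
      abs_of_nonneg (Real.sqrt_nonneg K)]
    calc _ ≤ _ := this
      _ = _ := by ring⟩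

/-! ### Noise coefficients -/

/-- Coefficients of the vector noise in `c₁ ∂_z (a(z) Ẇ^1) + c₂ a(z) ∇_x̲ · 𝕎̇^2`; since `a` does not
depend on `x̲`, the second term is `∑_{i ≥ 2} ∂_i (c₂ a(z) Ẇ^i)`. -/
def vectorCoeff (d : ℕ) [NeZero d] (c₁ c₂ : ℝ) (a : ℝ → ℝ) : Fin d → (Fin d → ℝ) → ℝ :=
  fun i x => (if i = 0 then c₁ else c₂) * a (x 0)

/-- Coefficient of the scalar noise in `c₃ b(z) Ẇ`. -/
def scalarCoeff (d : ℕ) [NeZero d] (c₃ : ℝ) (b : ℝ → ℝ) : (Fin d → ℝ) → ℝ :=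
  fun x => c₃ * b (x 0)

/-- `∫_0^t ∫ (|G|² + |∇G|²) dx ds`. -/
def energy {d : ℕ} {L : Fin d → ℝ} (G : SpaceTimeTest L) (t : ℝ) : ℝ :=
  ∫ s in (0 : ℝ)..t, ∫ x in cell L,
    ((G.slice s).1 x ^ 2 + ∑ i, (partialDeriv i (G.slice s)).1 x ^ 2)

end InterfaceFluctuation

end

open InterfaceFluctuation

/-!
The statement is a change of variables. Composition with the dilation `(y_1, y̲) ↦ (√K y_1, y̲)`,
multiplied by the square root `K^{1/4}` of its Jacobian, is an isometry from
`L²([0,∞) × √K 𝕋 × 𝕋^(d-1))` to `L²([0,∞) × 𝕋^d)` (`inner_dilationL2`), so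
`W'(h) = W(K^{1/4} h(t, √K y_1, y̲))` defines independent white noises on the stretched torus
(`AreIndepWhiteNoises.comp_isometry`). Testing the equation for `Φ` with the pulled back function
`G(t, √K y_1, y̲)` gives the equation for the stretched process, because the dilation conjugates the
two differential operators (`linearizedOperator_pullTest`), and because the isometry takes the
integrand of each noise in the stretched equation to `√K` times the integrand of the same noise in
the original one (`noiseIntegrand_spaceTimeDilation`). White
noise is not assumed linear: only the almost sure homogeneity `W(cf) = c W(f)` is needed, and it
follows from the covariance (`IsWhiteNoise.map_smul_ae`). Multiplication by `K^{-3/4}` gives the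
second equation (`IsSolution.const_smul`).

For the moment bound, the covariance identifies the second moment with the squared `L²` norm of the
integrand, and everything reduces to a bound on the coefficients which is uniform in `K`. As `g₁`
and `g₂` are controlled only on `[ρm, ρp]`, the one fact needed about the profile is that it takes
its values there. This is the maximum principle (`TransitionProfile.mem_Icc`): at a maximum of `v`,
`K f(v) = -v'' ≥ 0`, while `f < 0` above `ρp`.
-/

namespace InterfaceFluctuation

/-! ### The maximum principle for the transition profile -/

/-- The second derivative is nonpositive at a local maximum: were it positive, the point would
also be a local minimum, so the function would be locally constant. -/
theorem _root_.IsLocalMax.deriv_deriv_nonpos {h : ℝ → ℝ} {x : ℝ} (hmax : IsLocalMax h x)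
    (hc : ContinuousAt h x) : deriv (deriv h) x ≤ 0 := by
  by_contra! hpos
  have hmin := isLocalMin_of_deriv_deriv_pos hpos hmax.deriv_eq_zero hc
  have hconst : h =ᶠ[nhds x] fun _ => h x := by
    filter_upwards [hmax, hmin] with y h1 h2 using le_antisymm h1 h2
  have h0 : deriv (deriv h) x = 0 := by
    rw [hconst.deriv.deriv_eq]
    simp
  exact hpos.ne' h0

/-- A function decreasing through a zero `a` and without zeros to the right of `a` is negative
there. -/
theorem neg_of_deriv_neg_of_ne_zero {h : ℝ → ℝ} {a : ℝ} (hc : Continuous h) (ha : h a = 0)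
    (hd : deriv h a < 0) (hz : ∀ u, a < u → h u ≠ 0) {u : ℝ} (hu : a < u) : h u < 0 := by
  by_contra! hge
  have hsign := eventually_nhdsWithin_sign_eq_of_deriv_neg hd ha
  have hev : ∀ᶠ w in nhdsWithin a (Ioi a), h w < 0 := by
    filter_upwards [nhdsWithin_le_nhds hsign, self_mem_nhdsWithin] with w hw haw
    rw [sign_neg (sub_neg.2 haw), sign_eq_neg_one_iff] at hw
    exact hw
  obtain ⟨w, hw, hwu⟩ := (hev.and (Ioo_mem_nhdsGT hu)).exists
  obtain ⟨y, hy, hy0⟩ := intermediate_value_Icc hwu.2.le hc.continuousOn ⟨hw.le, hge⟩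
  exact hz y (hwu.1.trans_le hy.1) hy0

theorem BistableFunction.neg_of_gt (B : BistableFunction) {u : ℝ} (hu : B.ρp < u) : B.f u < 0 := by
  refine neg_of_deriv_neg_of_ne_zero B.smooth.continuous ((B.zeros _).2 (by simp)) B.deriv_ρp
    (fun w hw h0 => ?_) hu
  have := B.ρm_lt_ρs
  have := B.ρs_lt_ρp
  rcases (B.zeros w).1 h0 with h | h | h <;> linarith

theorem BistableFunction.pos_of_lt (B : BistableFunction) {u : ℝ} (hu : u < B.ρm) : 0 < B.f u := by
  -- Reflecting `u ↦ -u` and `f ↦ -f` exchanges the two stable zeros.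
  have key : -B.f (- -u) < 0 := by
    refine neg_of_deriv_neg_of_ne_zero (h := fun w => -B.f (-w)) (a := -B.ρm) (u := -u)
      (B.smooth.continuous.comp continuous_neg).neg ?_ ?_ (fun w hw h0 => ?_) (by linarith)
    · simp [(B.zeros B.ρm).2 (by simp)]
    · simpa [deriv_comp_neg] using B.deriv_ρm
    · have := B.ρm_lt_ρs
      have := B.ρs_lt_ρp
      rcases (B.zeros (-w)).1 (neg_eq_zero.1 h0) with h | h | h <;> linarith
  simpa using key

/-- Maximum principle: the profile takes its values between the stable zeros. At a maximum
`K f(v) = -v'' ≥ 0`, while `f` is negative above `ρp`; similarly at a minimum. -/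
theorem TransitionProfile.mem_Icc {B : BistableFunction} {K : ℝ} (V : TransitionProfile B K)
    (hK : 0 < K) (x : ℝ) : V.v x ∈ Icc B.ρm B.ρp := by
  have hc : Continuous V.v := V.contDiff.continuous
  have hcomp : IsCompact (range V.v) := V.periodic.compact_of_continuous one_ne_zero hc
  constructor
  · obtain ⟨_, ⟨x₀, rfl⟩, hx₀⟩ := hcomp.exists_isLeast (range_nonempty _)
    refine le_trans ?_ (hx₀ (mem_range_self x))
    by_contra! hlt
    have hmax : IsLocalMax (fun y => -V.v y) x₀ :=
      Filter.Eventually.of_forall fun y => neg_le_neg (hx₀ (mem_range_self y))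
    have h2 := hmax.deriv_deriv_nonpos hc.neg.continuousAt
    rw [show deriv (fun y => -V.v y) = fun y => -deriv V.v y from funext fun y => deriv.fun_neg,
      deriv.fun_neg] at h2
    have := mul_pos hK (B.pos_of_lt hlt)
    linarith [V.equation x₀]
  · obtain ⟨_, ⟨x₀, rfl⟩, hx₀⟩ := hcomp.exists_isGreatest (range_nonempty _)
    refine (hx₀ (mem_range_self x)).trans ?_
    by_contra! hlt
    have hmax : IsLocalMax V.v x₀ :=
      Filter.Eventually.of_forall fun y => hx₀ (mem_range_self y)
    have h2 := hmax.deriv_deriv_nonpos hc.continuousAt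
    have := mul_neg_of_pos_of_neg hK (B.neg_of_gt hlt)
    linarith [V.equation x₀]

/-! ### White noise -/

namespace IsWhiteNoise

variable {d : ℕ} {L : Fin d → ℝ} {Ω : Type*} [MeasurableSpace Ω] {W : NoiseField L Ω}
  {P : Measure Ω}

theorem memLp (hW : IsWhiteNoise W P) (h : Lp ℝ 2 (spaceTimeMeasure L)) : MemLp (W h) 2 P :=
  (hW.gaussian.hasGaussianLaw_eval h).memLp_two

/-- A white noise is almost surely homogeneous, because its covariance is:
`E[(W(cf) - c W(f))²] = ‖cf - cf‖² = 0`. -/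
theorem map_smul_ae (hW : IsWhiteNoise W P) (c : ℝ) (f : Lp ℝ 2 (spaceTimeMeasure L)) :
    ∀ᵐ η ∂P, W (c • f) η = c * W f η := by
  have i1 : Integrable (fun η => W (c • f) η * W (c • f) η) P :=
    (hW.memLp (c • f)).integrable_mul (hW.memLp (c • f))
  have i2 : Integrable (fun η => 2 * c * (W (c • f) η * W f η)) P :=
    ((hW.memLp (c • f)).integrable_mul (hW.memLp f)).const_mul (2 * c)
  have i3 : Integrable (fun η => c ^ 2 * (W f η * W f η)) P :=
    ((hW.memLp f).integrable_mul (hW.memLp f)).const_mul (c ^ 2)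
  have e : (fun η => (W (c • f) η - c * W f η) ^ 2) = fun η =>
      W (c • f) η * W (c • f) η - 2 * c * (W (c • f) η * W f η) + c ^ 2 * (W f η * W f η) := by
    funext η; ring
  have h0 : ∫ η, (W (c • f) η - c * W f η) ^ 2 ∂P = 0 := by
    rw [e, integral_add (by exact i1.sub i2) i3, integral_sub i1 i2, integral_const_mul,
      integral_const_mul, hW.covariance, hW.covariance, hW.covariance]
    simp only [real_inner_smul_left, real_inner_smul_right]
    ring
  have hint : Integrable (fun η => (W (c • f) η - c * W f η) ^ 2) P := by
    rw [e]; exact (i1.sub i2).add i3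
  filter_upwards [(integral_eq_zero_iff_of_nonneg (fun η => sq_nonneg _) hint).1 h0] with η hη
  exact sub_eq_zero.1 (pow_eq_zero_iff two_ne_zero |>.1 hη)

end IsWhiteNoise

/-- Precomposing independent white noises with an isometry of the index spaces gives independent
white noises. -/
theorem AreIndepWhiteNoises.comp_isometry {d : ℕ} {L L' : Fin d → ℝ} {Ω : Type*}
    [MeasurableSpace Ω] {W : Option (Fin d) → NoiseField L Ω} {P : Measure Ω}
    (hW : AreIndepWhiteNoises W P)
    (U : Lp ℝ 2 (spaceTimeMeasure L') → Lp ℝ 2 (spaceTimeMeasure L))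
    (hU : ∀ f g, inner ℝ (U f) (U g) = inner ℝ f g) :
    AreIndepWhiteNoises (fun j h => W j (U h)) P where
  whiteNoise j :=
    { measurable := fun h => (hW.whiteNoise j).measurable (U h)
      gaussian := (hW.whiteNoise j).gaussian.comp_right U
      mean := fun h => (hW.whiteNoise j).mean (U h)
      covariance := fun f g => by rw [(hW.whiteNoise j).covariance, hU] }
  indep := hW.indep.comp (fun _ w h => w (U h))
    fun _ => measurable_pi_lambda _ fun h => measurable_pi_apply (U h)

/-! ### Scaling of solutions -/

/-- Multiplying a solution of a linear equation by a constant multiplies the coefficients of the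
noises by the same constant. -/
theorem IsSolution.const_smul {d : ℕ} {L : Fin d → ℝ} {Ω : Type*} [MeasurableSpace Ω]
    {A : TestFn L →ₗ[ℝ] TestFn L} {σ : Fin d → (Fin d → ℝ) → ℝ} {τ : (Fin d → ℝ) → ℝ}
    {W : Option (Fin d) → NoiseField L Ω} {P : Measure Ω} {Φ : ℝ → Ω → TorusDistribution L}
    (hΦ : IsSolution A σ τ W P Φ) (hW : ∀ j, IsWhiteNoise (W j) P) (c : ℝ) :
    IsSolution A (fun i x => c * σ i x) (fun x => c * τ x) W P (fun t η => c • Φ t η) where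
  measurable t ht H := (hΦ.measurable t ht H).const_mul c
  continuous := by
    filter_upwards [hΦ.continuous] with η hη H using (hη H).const_smul c
  initial_indep := hΦ.initial_indep.comp
    (φ := fun (p : TestFn L → ℝ) H => c * p H) (ψ := id)
    (by fun_prop) measurable_id
  weak_eq G t ht := by
    obtain ⟨hL2, hG⟩ := hΦ.weak_eq G t ht
    have e : ∀ j, noiseIntegrand (fun i x => c * σ i x) (fun x => c * τ x) G t j
        = c • noiseIntegrand σ τ G t j := by
      rintro (_ | i) <;> funext p <;> simp [noiseIntegrand] <;> ring
    have hL2' : ∀ j, MemLp (noiseIntegrand (fun i x => c * σ i x) (fun x => c * τ x) G t j) 2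
        (spaceTimeMeasure L) := fun j => by rw [e j]; exact (hL2 j).const_smul c
    refine ⟨hL2', ?_⟩
    have eLp : ∀ j, (hL2' j).toLp _ = c • (hL2 j).toLp _ := fun j => by
      rw [← MemLp.toLp_const_smul]
      exact MemLp.toLp_congr _ _ (by rw [e j])
    filter_upwards [hG, ae_all_iff.2 fun j => (hW j).map_smul_ae c ((hL2 j).toLp _)] with η h1 h2
    have e1 : ∀ s H, pairing (c • Φ s η) H = c * pairing (Φ s η) H := fun _ _ => rfl
    simp only [e1, eLp, h2, intervalIntegral.integral_const_mul, ← Finset.mul_sum]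
    rw [h1]
    ring

/-! ### Calculus of the dilation -/

theorem measurableSet_cell {d : ℕ} (L : Fin d → ℝ) : MeasurableSet (cell L) :=
  MeasurableSet.univ_pi fun _ => measurableSet_Ico

section Dilation

variable {d : ℕ} [NeZero d] {K : ℝ}

theorem dilation_apply (y : Fin d → ℝ) (i : Fin d) :
    dilation d K y i = stretchedPeriods d K i * y i := rfl

theorem dilation_apply_zero (y : Fin d → ℝ) : dilation d K y 0 = √K * y 0 := by
  simp [dilation_apply, stretchedPeriods]

theorem dilation_single (i : Fin d) :
    dilation d K (Pi.single i 1) = stretchedPeriods d K i • Pi.single i (1 : ℝ) := by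
  ext j
  rcases eq_or_ne j i with rfl | hj
  · simp [dilation_apply]
  · simp [dilation_apply, Pi.single_eq_of_ne hj]

theorem stretchedPeriods_pos (hK : 0 < K) (i : Fin d) : 0 < stretchedPeriods d K i := by
  unfold stretchedPeriods
  split_ifs
  · exact Real.sqrt_pos.2 hK
  · exact one_pos

theorem TransitionProfile.vbar_sqrt_mul {B : BistableFunction} (V : TransitionProfile B K)
    (hK : 0 < K) (y : ℝ) : V.vbar (√K * y) = V.v y := by
  rw [vbar, mul_div_cancel_left₀ _ (Real.sqrt_pos.2 hK).ne']

/-- Chain rule for the dilation. -/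
theorem partialDeriv_pullTest (i : Fin d) (H : TestFn (stretchedPeriods d K)) :
    partialDeriv i (pullTest H) = stretchedPeriods d K i • pullTest (partialDeriv i H) := by
  apply Subtype.ext
  funext y
  have h : HasFDerivAt (fun y => H.1 (dilation d K y))
      ((fderiv ℝ H.1 (dilation d K y)).comp (dilation d K : (Fin d → ℝ) →L[ℝ] (Fin d → ℝ))) y :=
    ((H.2.1.differentiable (by simp)) _).hasFDerivAt.comp y (dilation d K).hasFDerivAt
  change fderiv ℝ (fun y => H.1 (dilation d K y)) y (Pi.single i 1)
    = stretchedPeriods d K i * fderiv ℝ H.1 (dilation d K y) (Pi.single i 1)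
  rw [h.fderiv, ContinuousLinearMap.comp_apply, dilation_single, map_smul, smul_eq_mul]

/-- The dilation conjugates `Δ + K f'(v)` to `-K 𝒜^K_z + Δ_x̲`: each of the two derivatives in the
first variable gains a factor `√K`. -/
theorem linearizedOperator_pullTest {B : BistableFunction} (V : TransitionProfile B K)
    (hK : 0 < K) (H : TestFn (stretchedPeriods d K)) :
    V.linearizedOperator d (pullTest H) = pullTest (V.stretchedOperator d H) := by
  have hmul : mulBy (V.potential d) (pullTest H) = pullTest (mulBy (V.stretchedPotential d) H) := by
    apply Subtype.ext
    funext y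
    change deriv B.f (V.v (y 0)) * H.1 (dilation d K y)
      = deriv B.f (V.vbar (dilation d K y 0)) * H.1 (dilation d K y)
    rw [dilation_apply_zero, V.vbar_sqrt_mul hK]
  have hdd : ∀ i : Fin d, partialDeriv i (partialDeriv i (pullTest H))
      = stretchedPeriods d K i ^ 2 • pullTest (partialDeriv i (partialDeriv i H)) := fun i => by
    rw [partialDeriv_pullTest, map_smul, partialDeriv_pullTest, smul_smul, sq]
  have h0 : stretchedPeriods d K 0 ^ 2 = K := by
    simp [stretchedPeriods, Real.sq_sqrt hK.le]
  have hlap : laplacian _ (pullTest H) = K • pullTest (partialDeriv 0 (partialDeriv 0 H))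
      + pullTest (tangentialLaplacian _ H) := by
    simp only [laplacian, tangentialLaplacian, LinearMap.sum_apply, LinearMap.comp_apply, map_sum,
      hdd]
    rw [← Finset.add_sum_erase _ _ (Finset.mem_univ (0 : Fin d)), h0, Finset.filter_ne']
    congr 1
    refine Finset.sum_congr rfl fun i hi => ?_
    simp [stretchedPeriods, Finset.ne_of_mem_erase hi]
  simp only [TransitionProfile.linearizedOperator, TransitionProfile.stretchedOperator,
    TransitionProfile.sturmLiouville, LinearMap.add_apply, LinearMap.smul_apply,
    LinearMap.neg_apply, LinearMap.sub_apply, LinearMap.comp_apply, map_add, map_neg, map_sub,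
    map_smul, hlap, hmul]
  module

/-- The space-time test function `(t, y) ↦ G(t, √K y_1, y̲)`. -/
noncomputable def SpaceTimeTest.pull (G : SpaceTimeTest (stretchedPeriods d K)) :
    SpaceTimeTest (unitPeriods d) where
  toFun t y := G.toFun t (dilation d K y)
  smooth := G.smooth.comp (contDiff_fst.prodMk ((dilation d K).contDiff.comp contDiff_snd))
  periodic t := (pullTest (G.slice t)).2.2

theorem SpaceTimeTest.slice_pull (G : SpaceTimeTest (stretchedPeriods d K)) (t : ℝ) :
    G.pull.slice t = pullTest (G.slice t) := rfl

theorem SpaceTimeTest.timeDeriv_pull (G : SpaceTimeTest (stretchedPeriods d K)) (t : ℝ) :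
    G.pull.timeDeriv t = pullTest (G.timeDeriv t) := rfl

theorem pairing_stretch (T : TorusDistribution (unitPeriods d))
    (H : TestFn (stretchedPeriods d K)) :
    pairing (stretch K T) H = √K * pairing T (pullTest H) := rfl

/-! ### The dilation as an isometry of `L²` -/

/-- The dilation of the space variables on space-time. -/
noncomputable def spaceTimeDilation (d : ℕ) [NeZero d] (K : ℝ) : ℝ × (Fin d → ℝ) → ℝ × (Fin d → ℝ) :=
  Prod.map id (dilation d K)

theorem measurable_spaceTimeDilation : Measurable (spaceTimeDilation d K) :=
  measurable_id.prodMap (dilation d K).continuous.measurable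

theorem dilation_preimage_cell (hK : 0 < K) :
    dilation d K ⁻¹' cell (stretchedPeriods d K) = cell (unitPeriods d) := by
  ext y
  simp only [mem_preimage, cell, mem_univ_pi, mem_Ico, dilation_apply, unitPeriods]
  refine forall_congr' fun i => ?_
  have hp := stretchedPeriods_pos (d := d) hK i
  constructor <;> rintro ⟨h1, h2⟩ <;> constructor <;> nlinarith

theorem smul_map_dilation (hK : 0 < K) :
    ENNReal.ofReal (√K) • (volume : Measure (Fin d → ℝ)).map (dilation d K) = volume := by
  have hprod : ∏ i, stretchedPeriods d K i = √K := by
    simp [stretchedPeriods, Finset.prod_ite_eq']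
  have hdet : (Matrix.diagonal (stretchedPeriods d K)).det = √K := by
    rw [Matrix.det_diagonal, hprod]
  have h := Real.smul_map_diagonal_volume_pi (D := stretchedPeriods d K)
    (by rw [hdet]; exact (Real.sqrt_pos.2 hK).ne')
  have hfun : ⇑(Matrix.toLin' (Matrix.diagonal (stretchedPeriods d K))) = dilation d K := by
    funext y i
    simp [Matrix.mulVec_diagonal, dilation_apply]
  rwa [hdet, abs_of_nonneg (Real.sqrt_nonneg K), hfun] at h

/-- The dilation multiplies the space-time volume by its Jacobian `√K`. -/
theorem smul_map_spaceTimeDilation (hK : 0 < K) :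
    ENNReal.ofReal (√K) • (spaceTimeMeasure (unitPeriods d)).map (spaceTimeDilation d K)
      = spaceTimeMeasure (stretchedPeriods d K) := by
  have hm := (dilation d K).continuous.measurable
  have hcell : ((volume : Measure (Fin d → ℝ)).restrict (cell (unitPeriods d))).map (dilation d K)
      = (volume.map (dilation d K)).restrict (cell (stretchedPeriods d K)) := by
    rw [Measure.restrict_map hm (measurableSet_cell _), dilation_preimage_cell hK]
  have hfin : SFinite ((volume.map (dilation d K)).restrict (cell (stretchedPeriods d K))) := by
    rw [← hcell]; infer_instance
  rw [spaceTimeMeasure, spaceTimeMeasure, spaceTimeDilation,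
    ← Measure.map_prod_map _ _ measurable_id hm, Measure.map_id, hcell, ← Measure.prod_smul_right,
    ← Measure.restrict_smul, smul_map_dilation hK]

theorem map_spaceTimeDilation (hK : 0 < K) :
    (spaceTimeMeasure (unitPeriods d)).map (spaceTimeDilation d K)
      = ENNReal.ofReal (√K)⁻¹ • spaceTimeMeasure (stretchedPeriods d K) := by
  have hs := Real.sqrt_pos.2 hK
  rw [← smul_map_spaceTimeDilation hK, smul_smul, ← ENNReal.ofReal_mul (inv_nonneg.2 hs.le),
    inv_mul_cancel₀ hs.ne', ENNReal.ofReal_one, one_smul]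

/-- The dilation is non-singular: it pulls null sets back to null sets. -/
theorem quasiMeasurePreserving_spaceTimeDilation (hK : 0 < K) :
    Measure.QuasiMeasurePreserving (spaceTimeDilation d K) (spaceTimeMeasure (unitPeriods d))
      (spaceTimeMeasure (stretchedPeriods d K)) where
  measurable := measurable_spaceTimeDilation
  absolutelyContinuous := by
    rw [map_spaceTimeDilation hK]
    exact Measure.smul_absolutelyContinuous

theorem memLp_comp_spaceTimeDilation (hK : 0 < K) {h : ℝ × (Fin d → ℝ) → ℝ}
    (hh : MemLp h 2 (spaceTimeMeasure (stretchedPeriods d K))) :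
    MemLp (fun p => h (spaceTimeDilation d K p)) 2 (spaceTimeMeasure (unitPeriods d)) := by
  refine MemLp.comp_of_map ?_ measurable_spaceTimeDilation.aemeasurable
  rw [map_spaceTimeDilation hK]
  exact hh.smul_measure ENNReal.ofReal_ne_top

/-- The map `h ↦ K^{1/4} h(t, √K y_1, y̲)` from `L²([0,∞) × √K 𝕋 × 𝕋^(d-1))` to
`L²([0,∞) × 𝕋^d)`; the factor is the square root of the Jacobian. -/
noncomputable def dilationL2 (hK : 0 < K) (h : Lp ℝ 2 (spaceTimeMeasure (stretchedPeriods d K))) :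
    Lp ℝ 2 (spaceTimeMeasure (unitPeriods d)) :=
  K ^ (1 / 4 : ℝ) • (memLp_comp_spaceTimeDilation hK (Lp.memLp h)).toLp _

theorem dilationL2_toLp (hK : 0 < K) {h : ℝ × (Fin d → ℝ) → ℝ}
    (hh : MemLp h 2 (spaceTimeMeasure (stretchedPeriods d K))) :
    dilationL2 hK (hh.toLp h) = K ^ (1 / 4 : ℝ) • (memLp_comp_spaceTimeDilation hK hh).toLp _ := by
  unfold dilationL2
  congr 1
  exact MemLp.toLp_congr _ _
    ((quasiMeasurePreserving_spaceTimeDilation hK).ae_eq_comp hh.coeFn_toLp)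

theorem inner_dilationL2 (hK : 0 < K) (f g : Lp ℝ 2 (spaceTimeMeasure (stretchedPeriods d K))) :
    inner ℝ (dilationL2 hK f) (dilationL2 hK g) = inner ℝ f g := by
  have hs := Real.sqrt_pos.2 hK
  have hKK : K ^ (1 / 4 : ℝ) * K ^ (1 / 4 : ℝ) = √K := by
    rw [← Real.rpow_add hK, Real.sqrt_eq_rpow]
    norm_num
  have hae : AEStronglyMeasurable (fun p => inner ℝ (f p) (g p))
      ((spaceTimeMeasure (unitPeriods d)).map (spaceTimeDilation d K)) := by
    rw [map_spaceTimeDilation hK]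
    exact ((Lp.aestronglyMeasurable f).inner (Lp.aestronglyMeasurable g)).smul_measure _
  have key : inner ℝ ((memLp_comp_spaceTimeDilation hK (Lp.memLp f)).toLp _)
      ((memLp_comp_spaceTimeDilation hK (Lp.memLp g)).toLp _) = (√K)⁻¹ * inner ℝ f g := by
    rw [L2.inner_def, L2.inner_def]
    calc _ = ∫ p, inner ℝ (f (spaceTimeDilation d K p)) (g (spaceTimeDilation d K p))
          ∂spaceTimeMeasure (unitPeriods d) := by
          refine integral_congr_ae ?_
          filter_upwards [(memLp_comp_spaceTimeDilation hK (Lp.memLp f)).coeFn_toLp,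
            (memLp_comp_spaceTimeDilation hK (Lp.memLp g)).coeFn_toLp] with p h1 h2
          rw [h1, h2]
      _ = ∫ p, inner ℝ (f p) (g p)
          ∂(spaceTimeMeasure (unitPeriods d)).map (spaceTimeDilation d K) :=
          (integral_map measurable_spaceTimeDilation.aemeasurable hae).symm
      _ = _ := by
          rw [map_spaceTimeDilation hK, integral_smul_measure,
            ENNReal.toReal_ofReal (inv_nonneg.2 hs.le), smul_eq_mul]
  rw [dilationL2, dilationL2, real_inner_smul_left, real_inner_smul_right, key, ← mul_assoc,
    ← mul_assoc, hKK, mul_inv_cancel₀ hs.ne', one_mul]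

end Dilation

/-! ### Square integrability of the noise integrands and the energy bound -/

section Energy

variable {d : ℕ} {L : Fin d → ℝ}

theorem SpaceTimeTest.continuous_partialDeriv (G : SpaceTimeTest L) (i : Fin d) :
    Continuous fun p : ℝ × (Fin d → ℝ) => (partialDeriv i (G.slice p.1)).1 p.2 := by
  have key : (fun p : ℝ × (Fin d → ℝ) => (partialDeriv i (G.slice p.1)).1 p.2) = fun p =>
      fderiv ℝ (fun q : ℝ × (Fin d → ℝ) => G.toFun q.1 q.2) p (0, Pi.single i 1) := by
    funext p
    have h1 := ((G.smooth.differentiable (by simp)) p).hasFDerivAt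
    have h2 : HasFDerivAt (fun x : Fin d → ℝ => (p.1, x))
        (ContinuousLinearMap.inr ℝ ℝ (Fin d → ℝ)) p.2 := hasFDerivAt_prodMk_right p.1 p.2
    have h3 := (h1.comp p.2 h2).fderiv
    change fderiv ℝ (G.toFun p.1) p.2 = _ at h3
    change fderiv ℝ (G.toFun p.1) p.2 (Pi.single i 1) = _
    rw [h3]
    simp
  rw [key]
  exact (G.smooth.continuous_fderiv (by simp)).clm_apply continuous_const

theorem spaceTimeMeasure_restrict (L : Fin d → ℝ) (t : ℝ) :
    (spaceTimeMeasure L).restrict (Icc 0 t ×ˢ univ)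
      = (volume.restrict (Icc 0 t)).prod (volume.restrict (cell L)) := by
  rw [spaceTimeMeasure, ← Measure.prod_restrict, Measure.restrict_univ,
    Measure.restrict_restrict measurableSet_Icc, inter_eq_left.2 Icc_subset_Ici_self]

theorem integrable_of_continuous {F : ℝ × (Fin d → ℝ) → ℝ} (hF : Continuous F) (t : ℝ) :
    Integrable F ((volume.restrict (Icc 0 t)).prod (volume.restrict (cell L))) := by
  rw [Measure.prod_restrict]
  have hsub : Icc 0 t ×ˢ cell L ⊆ Icc 0 t ×ˢ univ.pi fun i => Icc (-(L i) / 2) (L i / 2) :=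
    prod_mono_right (pi_mono fun _ _ => Ico_subset_Icc_self)
  exact (hF.continuousOn.integrableOn_compact
    (isCompact_Icc.prod (isCompact_univ_pi fun _ => isCompact_Icc))).mono_set hsub

theorem timeIndicator_mul_eq (F : ℝ × (Fin d → ℝ) → ℝ) (t : ℝ) :
    (fun p : ℝ × (Fin d → ℝ) => (Icc 0 t).indicator 1 p.1 * F p)
      = (Icc 0 t ×ˢ univ).indicator F := by
  funext p
  by_cases h : p.1 ∈ Icc 0 t
  · rw [indicator_of_mem h, indicator_of_mem (show p ∈ Icc 0 t ×ˢ univ from ⟨h, trivial⟩)]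
    simp
  · rw [indicator_of_notMem h, indicator_of_notMem fun h' => h h'.1, zero_mul]

theorem memLp_timeIndicator_mul {F : ℝ × (Fin d → ℝ) → ℝ} (hF : Continuous F) (t : ℝ) :
    MemLp (fun p : ℝ × (Fin d → ℝ) => (Icc 0 t).indicator 1 p.1 * F p) 2
      (spaceTimeMeasure L) := by
  rw [timeIndicator_mul_eq, memLp_indicator_iff_restrict (measurableSet_Icc.prod .univ),
    spaceTimeMeasure_restrict, memLp_two_iff_integrable_sq hF.aestronglyMeasurable]
  exact integrable_of_continuous (hF.pow 2) t

theorem integral_timeIndicator_mul_sq (F : ℝ × (Fin d → ℝ) → ℝ) (t : ℝ) :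
    ∫ p, ((Icc 0 t).indicator 1 p.1 * F p) ^ 2 ∂spaceTimeMeasure L
      = ∫ p, F p ^ 2 ∂(volume.restrict (Icc 0 t)).prod (volume.restrict (cell L)) := by
  have e : ∀ p : ℝ × (Fin d → ℝ), ((Icc 0 t).indicator 1 p.1 * F p) ^ 2
      = (Icc 0 t ×ˢ univ).indicator (fun p => F p ^ 2) p := fun p => by
    rw [congrFun (timeIndicator_mul_eq F t) p]
    by_cases h : p ∈ Icc 0 t ×ˢ (univ : Set (Fin d → ℝ)) <;> simp only [h, indicator_of_mem,
      indicator_of_notMem, not_false_eq_true, zero_pow two_ne_zero]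
  rw [integral_congr_ae (Filter.Eventually.of_forall e),
    integral_indicator (measurableSet_Icc.prod .univ), spaceTimeMeasure_restrict]

/-- The density `|G|² + |∇G|²`. -/
noncomputable def energyDensity (G : SpaceTimeTest L) (p : ℝ × (Fin d → ℝ)) : ℝ :=
  (G.slice p.1).1 p.2 ^ 2 + ∑ i, (partialDeriv i (G.slice p.1)).1 p.2 ^ 2

theorem continuous_energyDensity (G : SpaceTimeTest L) : Continuous (energyDensity G) :=
  (G.smooth.continuous.pow 2).add
    (continuous_finsetSum _ fun i _ => (G.continuous_partialDeriv i).pow 2)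

theorem energy_eq_integral (G : SpaceTimeTest L) {t : ℝ} (ht : 0 ≤ t) :
    energy G t
      = ∫ p, energyDensity G p ∂(volume.restrict (Icc 0 t)).prod (volume.restrict (cell L)) := by
  rw [energy, intervalIntegral.integral_of_le ht, ← integral_Icc_eq_integral_Ioc,
    integral_prod _ (integrable_of_continuous (continuous_energyDensity G) t)]
  rfl

/-- The function integrated against the `j`-th noise, without the time cut-off. -/
noncomputable def noiseDensity (σ : Fin d → (Fin d → ℝ) → ℝ) (τ : (Fin d → ℝ) → ℝ)
    (G : SpaceTimeTest L) : Option (Fin d) → ℝ × (Fin d → ℝ) → ℝ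
  | some i => fun p => -(σ i p.2 * (partialDeriv i (G.slice p.1)).1 p.2)
  | none => fun p => τ p.2 * (G.slice p.1).1 p.2

theorem noiseIntegrand_eq (σ : Fin d → (Fin d → ℝ) → ℝ) (τ : (Fin d → ℝ) → ℝ)
    (G : SpaceTimeTest L) (t : ℝ) (j : Option (Fin d)) :
    noiseIntegrand σ τ G t j = fun p => (Icc 0 t).indicator 1 p.1 * noiseDensity σ τ G j p := by
  cases j <;> rfl

theorem continuous_noiseDensity {σ : Fin d → (Fin d → ℝ) → ℝ} {τ : (Fin d → ℝ) → ℝ}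
    (hσ : ∀ i, Continuous (σ i)) (hτ : Continuous τ) (G : SpaceTimeTest L) (j : Option (Fin d)) :
    Continuous (noiseDensity σ τ G j) := by
  cases j with
  | none => exact (hτ.comp continuous_snd).mul G.smooth.continuous
  | some i => exact (((hσ i).comp continuous_snd).mul (G.continuous_partialDeriv i)).neg

theorem memLp_noiseIntegrand {σ : Fin d → (Fin d → ℝ) → ℝ} {τ : (Fin d → ℝ) → ℝ}
    (hσ : ∀ i, Continuous (σ i)) (hτ : Continuous τ) (G : SpaceTimeTest L) (t : ℝ)
    (j : Option (Fin d)) : MemLp (noiseIntegrand σ τ G t j) 2 (spaceTimeMeasure L) := by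
  rw [noiseIntegrand_eq]
  exact memLp_timeIndicator_mul (continuous_noiseDensity hσ hτ G j) t

theorem noiseDensity_sq_le {σ : Fin d → (Fin d → ℝ) → ℝ} {τ : (Fin d → ℝ) → ℝ} {M : ℝ}
    (hσM : ∀ i x, |σ i x| ≤ M) (hτM : ∀ x, |τ x| ≤ M) (G : SpaceTimeTest L) (j : Option (Fin d))
    (p : ℝ × (Fin d → ℝ)) : noiseDensity σ τ G j p ^ 2 ≤ M ^ 2 * energyDensity G p := by
  have hsum : 0 ≤ ∑ i, (partialDeriv i (G.slice p.1)).1 p.2 ^ 2 :=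
    Finset.sum_nonneg fun i _ => sq_nonneg _
  cases j with
  | none =>
    calc (τ p.2 * (G.slice p.1).1 p.2) ^ 2 = |τ p.2| ^ 2 * (G.slice p.1).1 p.2 ^ 2 := by
          rw [mul_pow, sq_abs]
      _ ≤ M ^ 2 * energyDensity G p :=
          mul_le_mul (pow_le_pow_left₀ (abs_nonneg _) (hτM _) 2) (le_add_of_nonneg_right hsum)
            (sq_nonneg _) (sq_nonneg _)
  | some i =>
    calc (-(σ i p.2 * (partialDeriv i (G.slice p.1)).1 p.2)) ^ 2
          = |σ i p.2| ^ 2 * (partialDeriv i (G.slice p.1)).1 p.2 ^ 2 := by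
          rw [neg_sq, mul_pow, sq_abs]
      _ ≤ M ^ 2 * energyDensity G p :=
          mul_le_mul (pow_le_pow_left₀ (abs_nonneg _) (hσM _ _) 2)
            ((Finset.single_le_sum (f := fun i => (partialDeriv i (G.slice p.1)).1 p.2 ^ 2)
              (fun i _ => sq_nonneg _) (Finset.mem_univ i)).trans
              (le_add_of_nonneg_left (sq_nonneg _))) (sq_nonneg _) (sq_nonneg _)

/-- By the Itô isometry, each noise with coefficients bounded by `M` contributes a second moment at
most `M²` times the energy. -/
theorem IsWhiteNoise.integral_sq_noiseIntegrand_le {Ω : Type*} [MeasurableSpace Ω]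
    {W : NoiseField L Ω} {P : Measure Ω} (hW : IsWhiteNoise W P)
    {σ : Fin d → (Fin d → ℝ) → ℝ} {τ : (Fin d → ℝ) → ℝ}
    (hσ : ∀ i, Continuous (σ i)) (hτ : Continuous τ) {M : ℝ}
    (hσM : ∀ i x, |σ i x| ≤ M) (hτM : ∀ x, |τ x| ≤ M) (G : SpaceTimeTest L) {t : ℝ} (ht : 0 ≤ t)
    (j : Option (Fin d)) :
    ∫ η, W ((memLp_noiseIntegrand hσ hτ G t j).toLp _) η ^ 2 ∂P ≤ M ^ 2 * energy G t := by
  have hcov := hW.covariance ((memLp_noiseIntegrand hσ hτ G t j).toLp _)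
    ((memLp_noiseIntegrand hσ hτ G t j).toLp _)
  simp only [← sq] at hcov
  rw [hcov, L2.inner_def]
  calc _ = ∫ p, noiseIntegrand σ τ G t j p ^ 2 ∂spaceTimeMeasure L := by
        refine integral_congr_ae ?_
        filter_upwards [(memLp_noiseIntegrand hσ hτ G t j).coeFn_toLp] with p hp
        rw [hp, real_inner_self_eq_norm_sq, Real.norm_eq_abs, sq_abs]
    _ = ∫ p, noiseDensity σ τ G j p ^ 2
          ∂(volume.restrict (Icc 0 t)).prod (volume.restrict (cell L)) := by
        rw [noiseIntegrand_eq, integral_timeIndicator_mul_sq]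
    _ ≤ ∫ p, M ^ 2 * energyDensity G p
          ∂(volume.restrict (Icc 0 t)).prod (volume.restrict (cell L)) :=
        integral_mono (integrable_of_continuous ((continuous_noiseDensity hσ hτ G j).pow 2) t)
          (integrable_of_continuous (continuous_const.mul (continuous_energyDensity G)) t)
          (noiseDensity_sq_le hσM hτM G j)
    _ = M ^ 2 * energy G t := by rw [integral_const_mul, energy_eq_integral G ht]

end Energy

/-! ### The stretched equation -/

section Stretch

variable {d : ℕ} [NeZero d] {K : ℝ}

theorem continuous_vectorCoeff {a : ℝ → ℝ} (ha : Continuous a) (c₁ c₂ : ℝ) (i : Fin d) :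
    Continuous (vectorCoeff d c₁ c₂ a i) :=
  continuous_const.mul (ha.comp (continuous_apply 0))

theorem continuous_scalarCoeff {b : ℝ → ℝ} (hb : Continuous b) (c₃ : ℝ) :
    Continuous (scalarCoeff d c₃ b) :=
  continuous_const.mul (hb.comp (continuous_apply 0))

/-- Power counting for the noises. Passing from the stretched to the unit torus costs `K^{1/4}` in
`L²`, the stretching of the distribution `√K`, and each derivative in the first variable
another `√K`: the exponents `3/4 = 1/2 + 1/2 - 1/4` and `1/4 = 1/2 - 1/4` result, and `3/4` again
for the scalar noise, whose coefficient contains `√K`. -/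
theorem noiseIntegrand_spaceTimeDilation {B : BistableFunction} (V : TransitionProfile B K)
    (hK : 0 < K) (g₁ g₂ : ℝ → ℝ) (G : SpaceTimeTest (stretchedPeriods d K)) (t : ℝ)
    (j : Option (Fin d)) (p : ℝ × (Fin d → ℝ)) :
    K ^ (1 / 4 : ℝ) * noiseIntegrand
        (vectorCoeff d (K ^ (3 / 4 : ℝ)) (K ^ (1 / 4 : ℝ)) fun z => g₁ (V.vbar z))
        (scalarCoeff d (K ^ (3 / 4 : ℝ)) fun z => g₂ (V.vbar z)) G t j (spaceTimeDilation d K p)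
      = √K * noiseIntegrand (vectorCoeff d 1 1 fun y => g₁ (V.v y))
        (scalarCoeff d (√K) fun y => g₂ (V.v y)) G.pull t j p := by
  have h1 : K ^ (1 / 4 : ℝ) * K ^ (3 / 4 : ℝ) = √K * √K := by
    rw [← Real.rpow_add hK, Real.mul_self_sqrt hK.le]
    norm_num
  have h2 : K ^ (1 / 4 : ℝ) * K ^ (1 / 4 : ℝ) = √K := by
    rw [← Real.rpow_add hK, Real.sqrt_eq_rpow]
    norm_num
  cases j with
  | none =>
    change _ * ((Icc 0 t).indicator 1 p.1 * (_ * g₂ (V.vbar (dilation d K p.2 0))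
        * G.toFun p.1 (dilation d K p.2)))
      = √K * ((Icc 0 t).indicator 1 p.1 * (√K * g₂ (V.v (p.2 0))
        * G.toFun p.1 (dilation d K p.2)))
    rw [dilation_apply_zero, V.vbar_sqrt_mul hK]
    linear_combination ((Icc 0 t).indicator 1 p.1 * g₂ (V.v (p.2 0))
        * G.toFun p.1 (dilation d K p.2)) * h1
  | some i =>
    have hd : (partialDeriv i (G.pull.slice p.1)).1 p.2 = stretchedPeriods d K i
        * (partialDeriv i (G.slice p.1)).1 (dilation d K p.2) := by
      rw [G.slice_pull, partialDeriv_pullTest]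
      rfl
    change _ * ((Icc 0 t).indicator 1 p.1 * -((if i = 0 then _ else _)
        * g₁ (V.vbar (dilation d K p.2 0)) * (partialDeriv i (G.slice p.1)).1 (dilation d K p.2)))
      = √K * ((Icc 0 t).indicator 1 p.1 * -((if i = 0 then 1 else 1) * g₁ (V.v (p.2 0))
        * (partialDeriv i (G.pull.slice p.1)).1 p.2))
    rw [hd, dilation_apply_zero, V.vbar_sqrt_mul hK, stretchedPeriods]
    split_ifs
    · linear_combination (-(Icc 0 t).indicator 1 p.1 * g₁ (V.v (p.2 0))
        * (partialDeriv i (G.slice p.1)).1 (dilation d K p.2)) * h1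
    · linear_combination (-(Icc 0 t).indicator 1 p.1 * g₁ (V.v (p.2 0))
        * (partialDeriv i (G.slice p.1)).1 (dilation d K p.2)) * h2

/-- The stretched process solves the stretched equation, driven by the noises
`W'(h) = W(K^{1/4} h(t, √K y_1, y̲))`. -/
theorem IsSolution.stretch {B : BistableFunction} (V : TransitionProfile B K) (hK : 0 < K)
    {g₁ g₂ : ℝ → ℝ} (hg₁ : Continuous fun z => g₁ (V.vbar z))
    (hg₂ : Continuous fun z => g₂ (V.vbar z)) {Ω : Type*} [MeasurableSpace Ω] {P : Measure Ω}
    {W : Option (Fin d) → NoiseField (unitPeriods d) Ω}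
    {Φ : ℝ → Ω → TorusDistribution (unitPeriods d)} (hW : ∀ j, IsWhiteNoise (W j) P)
    (hΦ : IsSolution (V.linearizedOperator d) (vectorCoeff d 1 1 fun y => g₁ (V.v y))
      (scalarCoeff d (√K) fun y => g₂ (V.v y)) W P Φ) :
    IsSolution (V.stretchedOperator d)
      (vectorCoeff d (K ^ (3 / 4 : ℝ)) (K ^ (1 / 4 : ℝ)) fun z => g₁ (V.vbar z))
      (scalarCoeff d (K ^ (3 / 4 : ℝ)) fun z => g₂ (V.vbar z))
      (fun j h => W j (dilationL2 hK h)) P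
      (fun t η => InterfaceFluctuation.stretch K (Φ t η)) where
  measurable t ht H := (hΦ.measurable t ht (pullTest H)).const_mul (√K)
  continuous := by
    filter_upwards [hΦ.continuous] with η hη H using (hη (pullTest H)).const_smul (√K)
  initial_indep := hΦ.initial_indep.comp
    (φ := fun (p : TestFn (unitPeriods d) → ℝ) (H : TestFn (stretchedPeriods d K)) =>
      √K * p (pullTest H))
    (ψ := fun (w : Option (Fin d) → Lp ℝ 2 (spaceTimeMeasure (unitPeriods d)) → ℝ) j h =>
      w j (dilationL2 hK h)) (by fun_prop) (by fun_prop)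
  weak_eq G t ht := by
    obtain ⟨hL2, hG⟩ := hΦ.weak_eq G.pull t ht
    have hL2' := memLp_noiseIntegrand
      (continuous_vectorCoeff (d := d) hg₁ (K ^ (3 / 4 : ℝ)) (K ^ (1 / 4 : ℝ)))
      (continuous_scalarCoeff (d := d) hg₂ (K ^ (3 / 4 : ℝ))) G t
    refine ⟨hL2', ?_⟩
    have eLp : ∀ j, dilationL2 hK ((hL2' j).toLp _) = √K • (hL2 j).toLp _ := fun j => by
      rw [dilationL2_toLp, ← MemLp.toLp_const_smul, ← MemLp.toLp_const_smul]
      refine MemLp.toLp_congr _ _ (Filter.Eventually.of_forall fun p => ?_)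
      exact noiseIntegrand_spaceTimeDilation V hK g₁ g₂ G t j p
    filter_upwards [hG, ae_all_iff.2 fun j => (hW j).map_smul_ae (√K) ((hL2 j).toLp _)]
      with η h1 h2
    simp only [G.slice_pull, G.timeDeriv_pull, linearizedOperator_pullTest V hK, ← map_add] at h1
    simp only [pairing_stretch, eLp, h2, intervalIntegral.integral_const_mul, ← Finset.mul_sum]
    rw [h1]
    ring

end Stretch

/-! ### Normalization by `K^{-3/4}` -/

theorem rpow_mul_vectorCoeff (d : ℕ) [NeZero d] {K : ℝ} (hK : 0 < K) (a : ℝ → ℝ) :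
    (fun i x => K ^ (-3 / 4 : ℝ) * vectorCoeff d (K ^ (3 / 4 : ℝ)) (K ^ (1 / 4 : ℝ)) a i x)
      = vectorCoeff d 1 (K ^ (-1 / 2 : ℝ)) a := by
  have h1 : K ^ (-3 / 4 : ℝ) * K ^ (3 / 4 : ℝ) = 1 := by
    rw [← Real.rpow_add hK]
    norm_num
  have h2 : K ^ (-3 / 4 : ℝ) * K ^ (1 / 4 : ℝ) = K ^ (-1 / 2 : ℝ) := by
    rw [← Real.rpow_add hK]
    norm_num
  funext i x
  simp only [vectorCoeff]
  split_ifs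
  · rw [← mul_assoc, h1]
  · rw [← mul_assoc, h2]

theorem rpow_mul_scalarCoeff (d : ℕ) [NeZero d] {K : ℝ} (hK : 0 < K) (b : ℝ → ℝ) :
    (fun x => K ^ (-3 / 4 : ℝ) * scalarCoeff d (K ^ (3 / 4 : ℝ)) b x) = scalarCoeff d 1 b := by
  have h1 : K ^ (-3 / 4 : ℝ) * K ^ (3 / 4 : ℝ) = 1 := by
    rw [← Real.rpow_add hK]
    norm_num
  funext x
  rw [scalarCoeff, scalarCoeff, ← mul_assoc, h1]

end InterfaceFluctuation

theorem mainTheorem6 (d : ℕ) [NeZero d] (B : BistableFunction) (g₁ g₂ : ℝ → ℝ)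
    (hg₁ : ContDiffOn ℝ ∞ g₁ (Icc B.ρm B.ρp)) (hg₂ : ContDiffOn ℝ ∞ g₂ (Icc B.ρm B.ρp))
    (hg₁_pos : ∀ u ∈ Icc B.ρm B.ρp, 0 < g₁ u) (hg₂_pos : ∀ u ∈ Icc B.ρm B.ρp, 0 < g₂ u) :
    ∃ C : ℝ, ∀ (K : ℝ), 1 ≤ K → ∀ (V : TransitionProfile B K)
      (Ω : Type*) [MeasurableSpace Ω] (P : Measure Ω) [IsProbabilityMeasure P]
      (W : Option (Fin d) → NoiseField (unitPeriods d) Ω)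
      (Φ : ℝ → Ω → TorusDistribution (unitPeriods d)),
      AreIndepWhiteNoises W P →
      IsSolution (V.linearizedOperator d) (vectorCoeff d 1 1 fun y => g₁ (V.v y))
        (scalarCoeff d (√K) fun y => g₂ (V.v y)) W P Φ →
      ∃ W' : Option (Fin d) → NoiseField (stretchedPeriods d K) Ω,
        AreIndepWhiteNoises W' P ∧
        IsSolution (V.stretchedOperator d)
          (vectorCoeff d (K ^ (3 / 4 : ℝ)) (K ^ (1 / 4 : ℝ)) fun z => g₁ (V.vbar z))
          (scalarCoeff d (K ^ (3 / 4 : ℝ)) fun z => g₂ (V.vbar z)) W' P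
          (fun t η => stretch K (Φ t η)) ∧
        IsSolution (V.stretchedOperator d)
          (vectorCoeff d 1 (K ^ (-1 / 2 : ℝ)) fun z => g₁ (V.vbar z))
          (scalarCoeff d 1 fun z => g₂ (V.vbar z)) W' P
          (fun t η => K ^ (-3 / 4 : ℝ) • stretch K (Φ t η)) ∧
        ∀ (G : SpaceTimeTest (stretchedPeriods d K)) (t : ℝ), 0 ≤ t → ∀ j,
          ∃ hL2 : MemLp (noiseIntegrand (vectorCoeff d 1 (K ^ (-1 / 2 : ℝ)) fun z => g₁ (V.vbar z))
              (scalarCoeff d 1 fun z => g₂ (V.vbar z)) G t j) 2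
              (spaceTimeMeasure (stretchedPeriods d K)),
            ∫ η, W' j (hL2.toLp _) η ^ 2 ∂P ≤ C * energy G t := by
  obtain ⟨M₁, hM₁⟩ := isCompact_Icc.exists_bound_of_continuousOn hg₁.continuousOn
  obtain ⟨M₂, hM₂⟩ := isCompact_Icc.exists_bound_of_continuousOn hg₂.continuousOn
  refine ⟨max M₁ M₂ ^ 2, fun K hK V Ω _ P _ W Φ hW hΦ => ?_⟩
  have hK0 : 0 < K := zero_lt_one.trans_le hK
  have hv : ∀ z, V.vbar z ∈ Icc B.ρm B.ρp := fun z => V.mem_Icc hK0 _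
  have hc₁ : Continuous fun z => g₁ (V.vbar z) :=
    hg₁.continuousOn.comp_continuous V.vbar_smooth.continuous hv
  have hc₂ : Continuous fun z => g₂ (V.vbar z) :=
    hg₂.continuousOn.comp_continuous V.vbar_smooth.continuous hv
  have hW' := hW.comp_isometry (dilationL2 hK0) (inner_dilationL2 hK0)
  have hstretch := hΦ.stretch V hK0 hc₁ hc₂ hW.whiteNoise
  have hscaled := hstretch.const_smul hW'.whiteNoise (K ^ (-3 / 4 : ℝ))
  rw [rpow_mul_vectorCoeff d hK0, rpow_mul_scalarCoeff d hK0] at hscaled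
  refine ⟨_, hW', hstretch, hscaled, fun G t ht j => ⟨memLp_noiseIntegrand
    (continuous_vectorCoeff hc₁ _ _) (continuous_scalarCoeff hc₂ _) G t j, ?_⟩⟩
  refine (hW'.whiteNoise j).integral_sq_noiseIntegrand_le (continuous_vectorCoeff hc₁ _ _)
    (continuous_scalarCoeff hc₂ _) (fun i x => ?_) (fun x => ?_) G ht j
  · -- The coefficients `1` and `K^{-1/2}` of the vector noise are at most `1`, as `K ≥ 1`.
    have hcoef : |if i = 0 then (1 : ℝ) else K ^ (-1 / 2 : ℝ)| ≤ 1 := by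
      split_ifs
      · exact abs_one.le
      · rw [abs_of_nonneg (Real.rpow_nonneg hK0.le _)]
        exact Real.rpow_le_one_of_one_le_of_nonpos hK (by norm_num)
    calc |vectorCoeff d 1 (K ^ (-1 / 2 : ℝ)) (fun z => g₁ (V.vbar z)) i x|
        ≤ 1 * |g₁ (V.vbar (x 0))| := by
          rw [vectorCoeff, abs_mul]
          exact mul_le_mul_of_nonneg_right hcoef (abs_nonneg _)
      _ ≤ max M₁ M₂ := by
          rw [one_mul]
          exact (hM₁ _ (hv _)).trans (le_max_left _ _)
  · rw [scalarCoeff, one_mul]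
    exact (hM₂ _ (hv _)).trans (le_max_right _ _)
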